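/- Let $\alpha,\beta\ge 1$ be odd and $n_\alpha,n_\beta\ge 1$. Consider a boundary divided into $N+1=n_\alpha\alpha+n_\beta\beta$ disjoint regions (one of them being the purifier), $a_{(i,s)}$ with $1\le s\le n_\alpha$, $i\in\mathbb Z/\alpha$, and $b_{(j,t)}$ with $1\le t\le n_\beta$, $j\in\mathbb Z/\beta$. For a cyclic family $x=(x_i)_{i\in\mathbb Z/m}$, $m$ odd, write $x_i^{\pm}=x_i\cup x_{i+1}\cup\dots\cup x_{i+\frac{m\pm1}{2}-1}$, and write juxtaposition for union. Put $a^\pm_{i_s}=a^\pm_{(i_s,s)}$, $b^\pm_{j_t}=b^\pm_{(j_t,t)}$ and $A_s=\bigcup_i a_{(i,s)}$. *Holographic entropy inequalities.* A discrete holographic geometry is a finite undirected graph with nonnegative edge weights, in which some vertices are boundary vertices, each assigned to one of the $N+1$ regions. For a set $I$ of regions, $S_I$ is the discrete Ryu–Takayanagi entropy: the minimal total weight of the edges between $W$ and its complement, over all vertex sets $W$ whose boundary vertices are exactly those assigned to the regions in $I$. An inequality $\sum_u c_uS_{L_u}\ge\sum_v d_vS_{R_v}$ with nonnegative coefficients is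 a holographic entropy inequality (HEI) if it holds for every such geometry. Inequalities are regarded as pairs of formal combinations (left-hand side, right-hand side) and are added side by side. *Toric inequalities.* For nonempty disjoint regions $a'_i$ ($i\in\mathbb Z/\alpha$), $b'_j$ ($j\in\mathbb Z/\beta$), each a union of some of the $N+1$ regions and together exhausting the boundary, the toric $(\alpha;\beta)$-inequality is $$\sum_{i,j}S_{a_i'^{+}b_j'^{-}}\ \ge\ \sum_{i,j}S_{a_i'^{-}b_j'^{-}}+S_{\bigcup_i a'_i}.$$ *Tori.* Let $G_{\{\alpha\}}$ be the graph on $(\mathbb Z/\alpha)^{n_\alpha}$ in which two distinct vertices are adjacent if their difference is $\pm(\frac{\alpha-1}2,\dots,\frac{\alpha-1}2)$, define $G_{\{\beta\}}$ on $(\mathbb Z/\beta)^{n_\beta}$ likewise, and let $G=G_{\{\alpha\}}\,\Box\,G_{\{\beta\}}$ (Cartesian product). This is the graph underlying $T_{\mathcal R}$, its vertex $(i,j)$ carrying the label $a^-_{i_1}\cdots a^-_{i_{n_\alpha}}b^-_{j_1}\cdots b^-_{j_{n_\beta}}$. The connected components $\tau$ of $G$ are the tori of $T_{\mathcal R}$.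 **Statement.** The $(\alpha,\dots,\alpha;\beta,\dots,\beta)$-inequality $$\sum_{i\in(\mathbb Z/\alpha)^{n_\alpha}}\ \sum_{j\in(\mathbb Z/\beta)^{n_\beta}}S_{a^+_{i_1}\cdots a^+_{i_{n_\alpha}}b^-_{j_1}\cdots b^-_{j_{n_\beta}}}\ \ge\ \sum_{i\in(\mathbb Z/\alpha)^{n_\alpha}}\ \sum_{j\in(\mathbb Z/\beta)^{n_\beta}}S_{a^-_{i_1}\cdots a^-_{i_{n_\alpha}}b^-_{j_1}\cdots b^-_{j_{n_\beta}}}+\alpha^{n_\alpha-1}\beta^{n_\beta-1}S_{A_1\cdots A_{n_\alpha}}$$ is a holographic entropy inequality, and it is redundant in the following sense: it is a sum of toric $(\alpha;\beta)$-inequalities, one for each torus. Precisely: $G$ has exactly $\alpha^{n_\alpha-1}\beta^{n_\beta-1}$ connected components $\tau$, each isomorphic to the toroidal graph $C_\alpha\,\Box\,C_\beta$ (where $C_1$ is a single vertex); and for each $\tau$ there are regions $a'_i,b'_j$ as above whose toric $(\alpha;\beta)$-inequality is an HEI, is equal to $$\sum_{(i,j)\in\tau}S_{a^+_{i_1}\cdots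 a^+_{i_{n_\alpha}}b^-_{j_1}\cdots b^-_{j_{n_\beta}}}\ \ge\ \sum_{(i,j)\in\tau}S_{a^-_{i_1}\cdots a^-_{i_{n_\alpha}}b^-_{j_1}\cdots b^-_{j_{n_\beta}}}+S_{A_1\cdots A_{n_\alpha}},$$ and such that the sum of these toric inequalities over all $\tau$ is the $(\alpha,\dots,\alpha;\beta,\dots,\beta)$-inequality. -/

import Mathlib

open scoped NNReal

/-- A discrete holographic geometry on the (monochromatic) boundary regions `R`: a finite
undirected graph with nonnegative edge weights (weight `0` means that there is no edge), in which
some vertices are boundary vertices and each boundary vertex belongs to one region.  The list `R`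
contains the purifier, so that the total state is pure. -/
structure HolographicGraph (R : Type*) where
  /-- The vertices. -/
  V : Type
  [fintypeV : Fintype V]
  [decEqV : DecidableEq V]
  /-- The weight of the edge between two vertices. -/
  weight : V → V → ℝ
  weight_symm : ∀ x y, weight x y = weight y x
  weight_nonneg : ∀ x y, 0 ≤ weight x y
  /-- The region of a boundary vertex; `none` for a bulk vertex. -/
  region : V → Option R

attribute [instance] HolographicGraph.fintypeV HolographicGraph.decEqV

namespace HolographicGraph

variable {R : Type*} (M : HolographicGraph R)

/-- The area of the cut surface between `W` and its complement. -/
def cutArea (W : Finset M.V) : ℝ :=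
  ∑ x ∈ W, ∑ y ∈ Wᶜ, M.weight x y

open Classical in
/-- The bulk regions homologous to the boundary region `I`: the vertex sets whose boundary
vertices are exactly the boundary vertices of the regions in `I`. -/
noncomputable def homologyRegions (I : Finset R) : Finset (Finset M.V) :=
  Finset.univ.filter fun W => ∀ v r, M.region v = some r → (v ∈ W ↔ r ∈ I)

theorem homologyRegions_nonempty (I : Finset R) : (M.homologyRegions I).Nonempty := by
  classical
  refine ⟨Finset.univ.filter fun v => ∃ r ∈ I, M.region v = some r, ?_⟩
  simp only [homologyRegions, Finset.mem_filter, Finset.mem_univ, true_and]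
  intro v r h
  constructor
  · rintro ⟨r', hr', h'⟩
    rw [h] at h'
    cases h'
    exact hr'
  · intro hr
    exact ⟨r, hr, h⟩

/-- The holographic entanglement entropy `S_I` (Ryu-Takayanagi): the least area of a cut
homologous to `I`, in units `4 G_N = 1`. -/
noncomputable def entropy (I : Finset R) : ℝ :=
  (M.homologyRegions I).inf' (M.homologyRegions_nonempty I) M.cutArea

end HolographicGraph

/-- A formal entropy inequality `∑ c_u S_{L_u} ≥ ∑ d_v S_{R_v}`: the first component is the formal
combination on the left, the second the one on the right. The sum of two inequalities is taken
side by side. -/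
abbrev EntropyInequality (R : Type*) := (Finset R →₀ ℝ≥0) × (Finset R →₀ ℝ≥0)

/-- The formal term `c • S_I`. -/
noncomputable abbrev entropyTerm {R : Type*} (I : Finset R) (c : ℝ≥0 := 1) : Finset R →₀ ℝ≥0 :=
  Finsupp.single I c

/-- `q` is a holographic entropy inequality: it holds for every holographic geometry. -/
def IsHEI {R : Type*} (q : EntropyInequality R) : Prop :=
  ∀ M : HolographicGraph R,
    (q.2.sum fun I d => (d : ℝ) * M.entropy I) ≤ q.1.sum fun I c => (c : ℝ) * M.entropy I

section Toric

variable {R : Type*} [DecidableEq R]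

/-- `a_i^{(k)} = a_i a_{i+1} ⋯ a_{i+k-1}`, indices mod `α`. -/
def consecutive {α : ℕ} (a : ZMod α → Finset R) (k : ℕ) (i : ZMod α) : Finset R :=
  (Finset.range k).biUnion fun m => a (i + (m : ZMod α))

/-- `a_i^+ = a_i^{((α+1)/2)}`. -/
def plusRegion {α : ℕ} (a : ZMod α → Finset R) (i : ZMod α) : Finset R :=
  consecutive a ((α + 1) / 2) i

/-- `a_i^- = a_i^{((α-1)/2)}`. -/
def minusRegion {α : ℕ} (a : ZMod α → Finset R) (i : ZMod α) : Finset R :=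
  consecutive a ((α - 1) / 2) i

/-- The regions `a_i`, `b_j` (possibly unions of several monochromatic regions) are nonempty,
disjoint, and together exhaust the boundary. -/
def IsBoundaryPartition {α β : ℕ} (a : ZMod α → Finset R) (b : ZMod β → Finset R) : Prop :=
  (∀ i, (a i).Nonempty) ∧ (∀ j, (b j).Nonempty) ∧
    ∀ r, ∃! x : ZMod α ⊕ ZMod β, r ∈ Sum.elim a b x

/-- The toric `(α;β)`-inequality
`∑_{i,j} S_{a_i^+ b_j^-} ≥ ∑_{i,j} S_{a_i^- b_j^-} + S_{a_1 ⋯ a_α}`. -/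
noncomputable def toricInequality {α β : ℕ} [NeZero α] [NeZero β]
    (a : ZMod α → Finset R) (b : ZMod β → Finset R) : EntropyInequality R :=
  (∑ i, ∑ j, entropyTerm (plusRegion a i ∪ minusRegion b j),
    (∑ i, ∑ j, entropyTerm (minusRegion a i ∪ minusRegion b j))
      + entropyTerm (Finset.univ.biUnion a))

end Toric

section GeneralizedToric

variable (α β nα nβ : ℕ)

/-- The monochromatic regions: `a_{(i,s)}` is `Sum.inl (s, i)`, `b_{(j,t)}` is `Sum.inr (t, j)`. -/
abbrev Region := (Fin nα × ZMod α) ⊕ (Fin nβ × ZMod β)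

/-- The multi-indices `(i_1, …, i_{n_α}; j_1, …, j_{n_β})`. -/
abbrev MultiIndex := (Fin nα → ZMod α) × (Fin nβ → ZMod β)

variable {α β nα nβ}

/-- The region `a_{(i,s)}`. -/
def aRegion (s : Fin nα) (i : ZMod α) : Finset (Region α β nα nβ) := {Sum.inl (s, i)}

/-- The region `b_{(j,t)}`. -/
def bRegion (t : Fin nβ) (j : ZMod β) : Finset (Region α β nα nβ) := {Sum.inr (t, j)}

/-- `a^+_{i_1} ⋯ a^+_{i_{n_α}} b^-_{j_1} ⋯ b^-_{j_{n_β}}`. -/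
def leftRegion (u : MultiIndex α β nα nβ) : Finset (Region α β nα nβ) :=
  (Finset.univ.biUnion fun s => plusRegion (aRegion s) (u.1 s)) ∪
    Finset.univ.biUnion fun t => minusRegion (bRegion t) (u.2 t)

/-- `a^-_{i_1} ⋯ a^-_{i_{n_α}} b^-_{j_1} ⋯ b^-_{j_{n_β}}`. -/
def rightRegion (v : MultiIndex α β nα nβ) : Finset (Region α β nα nβ) :=
  (Finset.univ.biUnion fun s => minusRegion (aRegion s) (v.1 s)) ∪
    Finset.univ.biUnion fun t => minusRegion (bRegion t) (v.2 t)

variable (α β nα nβ)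

/-- `A_1 ⋯ A_{n_α}`. -/
def allA [NeZero α] : Finset (Region α β nα nβ) :=
  Finset.univ.biUnion fun s => Finset.univ.biUnion fun i => aRegion s i

/-- The `(α,…,α;β,…,β)`-inequality, with `n_α` entries `α` and `n_β` entries `β`, and
non-geometric term `α^(n_α-1) β^(n_β-1) S_{A_1 ⋯ A_{n_α}}`. -/
noncomputable def generalizedToricInequality [NeZero α] [NeZero β] :
    EntropyInequality (Region α β nα nβ) :=
  (∑ u : MultiIndex α β nα nβ, entropyTerm (leftRegion u),
    (∑ v : MultiIndex α β nα nβ, entropyTerm (rightRegion v))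
      + entropyTerm (allA α β nα nβ) ((α : ℝ≥0) ^ (nα - 1) * (β : ℝ≥0) ^ (nβ - 1)))

/-- The graph `G_{{α}}` on the multi-indices `(i_1, …, i_n)`: the neighbours of a vertex are
obtained by shifting all its indices by `(α-1)/2`, or all by `-(α-1)/2`. -/
def multiCycleGraph (α n : ℕ) : SimpleGraph (Fin n → ZMod α) :=
  SimpleGraph.fromRel fun i i' => ∀ s, i s - i' s = (((α - 1) / 2 : ℕ) : ZMod α)

/-- The graph underlying `T_R`, `G_R = G_{{α}} □ G_{{β}}`, where the vertex `(i, j)` carries the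
label `rightRegion (i, j)`. With the labels `leftRegion` it is `G_L`. -/
def torusGraph : SimpleGraph (MultiIndex α β nα nβ) :=
  (multiCycleGraph α nα).boxProd (multiCycleGraph β nβ)

/-- The disjoint tori into which `T_R` decomposes. -/
abbrev Torus := (torusGraph α β nα nβ).ConnectedComponent

noncomputable instance [NeZero α] [NeZero β] : Fintype (Torus α β nα nβ) := Fintype.ofFinite _

variable {α β nα nβ}

open Classical in
/-- The part of the generalized inequality that belongs to one torus `τ`: the geometric terms with
indices in `τ`, and one copy of the non-geometric term. -/
noncomputable def torusPart [NeZero α] [NeZero β] (τ : Torus α β nα nβ) :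
    EntropyInequality (Region α β nα nβ) :=
  (∑ u with u ∈ τ.supp, entropyTerm (leftRegion u),
    (∑ v with v ∈ τ.supp, entropyTerm (rightRegion v)) + entropyTerm (allA α β nα nβ))

end GeneralizedToric

/-! Two independent facts combine. First, $\frac{\alpha-1}2$ generates $\mathbb Z/\alpha$, so the
component of $u$ in `torusGraph` is its orbit under common shifts of all first and all second
indices. These shifts act freely, which gives the number and the shape of the tori. Gluing the
regions $a_{(u_s+i,s)}$ over $s$ into one region $a'_i$, and likewise for $b$, turns a toric
inequality into the part belonging to that orbit.

Second, the toric inequality is proved by contraction. A bit string $x$ chooses one diagonal in each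
square of a torus, hence a graph $\Gamma_x$ on $\mathbb Z/\alpha\times\mathbb Z/\beta$. The output
bits are the pivots (first support vertices) of the space of rational functions that change sign
along every edge of $\Gamma_x$. One further bit says whether the `false` edges form a coboundary mod
2.

The identity `sum_diagonalSum_mul_comm` says that the vectors of all diagonal sums form an isotropic
space. Hence, among functions satisfying all conditions away from one square, the two diagonal sums
there span at most a line, and flipping that diagonal changes at most one pivot
(`eq_of_isPivot_ne`). By `exists_isPotential`, the `false` or the `true` edges always form a
coboundary. When the extra bit flips, potentials of the two types add up to a function which forces
the pivots to stay fixed (`isPivot_iff_of_isPotential`). So one input flip changes at most one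
output bit. -/

/-! ### Cuts, entropies and proof by contraction -/

theorem HolographicGraph.two_mul_cutArea {R : Type*} (M : HolographicGraph R) (W : Finset M.V) :
    2 * M.cutArea W =
      ∑ p, ∑ q, M.weight p q * (if decide (p ∈ W) ≠ decide (q ∈ W) then 1 else 0) := by
  have h1 : M.cutArea W = ∑ p, ∑ q, M.weight p q * (if p ∈ W ∧ q ∉ W then 1 else 0) := by
    rw [HolographicGraph.cutArea, ← Finset.sum_subset (Finset.subset_univ W)]
    · refine Finset.sum_congr rfl fun p hp => ?_
      rw [← Finset.sum_subset (Finset.subset_univ Wᶜ)]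
      · refine Finset.sum_congr rfl fun q hq => ?_
        simp [hp, Finset.mem_compl.1 hq]
      · intro q _ hq
        simp_all
    · intro p _ hp
      simp [hp]
  have h2 : M.cutArea W = ∑ p, ∑ q, M.weight p q * (if q ∈ W ∧ p ∉ W then 1 else 0) := by
    rw [h1, Finset.sum_comm]
    simp only [M.weight_symm]
  rw [two_mul]
  nth_rw 1 [h1]
  rw [h2, ← Finset.sum_add_distrib]
  refine Finset.sum_congr rfl fun p _ => ?_
  rw [← Finset.sum_add_distrib]
  refine Finset.sum_congr rfl fun q _ => ?_
  by_cases hp : p ∈ W <;> by_cases hq : q ∈ W <;> simp [hp, hq]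

theorem HolographicGraph.exists_cutArea_eq_entropy {R : Type*} (M : HolographicGraph R)
    (I : Finset R) :
    ∃ W : Finset M.V, (∀ v r, M.region v = some r → (v ∈ W ↔ r ∈ I)) ∧
      M.cutArea W = M.entropy I := by
  obtain ⟨W, hW, h⟩ := Finset.exists_mem_eq_inf' (M.homologyRegions_nonempty I) M.cutArea
  exact ⟨W, by simpa [HolographicGraph.homologyRegions] using hW, h.symm⟩

theorem HolographicGraph.entropy_le_cutArea {R : Type*} (M : HolographicGraph R)
    {I : Finset R} {W : Finset M.V} (hW : ∀ v r, M.region v = some r → (v ∈ W ↔ r ∈ I)) :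
    M.entropy I ≤ M.cutArea W :=
  Finset.inf'_le _ (by simpa [HolographicGraph.homologyRegions] using hW)

/-- The value of a formal combination of entropies. -/
noncomputable def HolographicGraph.evalEntropy {R : Type*} (M : HolographicGraph R) :
    (Finset R →₀ ℝ≥0) →+ ℝ :=
  Finsupp.liftAddHom fun I =>
    (AddMonoidHom.mulRight (M.entropy I)).comp NNReal.toRealHom.toAddMonoidHom

theorem HolographicGraph.evalEntropy_apply {R : Type*} (M : HolographicGraph R)
    (q : Finset R →₀ ℝ≥0) : M.evalEntropy q = q.sum fun I c => (c : ℝ) * M.entropy I := rfl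

theorem HolographicGraph.evalEntropy_entropyTerm {R : Type*} (M : HolographicGraph R)
    (I : Finset R) (c : ℝ≥0) : M.evalEntropy (entropyTerm I c) = c * M.entropy I := by
  rw [M.evalEntropy_apply, Finsupp.sum_single_index] <;> simp

theorem isHEI_iff {R : Type*} (q : EntropyInequality R) :
    IsHEI q ↔ ∀ M : HolographicGraph R, M.evalEntropy q.2 ≤ M.evalEntropy q.1 := Iff.rfl

theorem IsHEI.sum {R ι : Type*} (s : Finset ι) (q : ι → EntropyInequality R)
    (h : ∀ i ∈ s, IsHEI (q i)) : IsHEI (∑ i ∈ s, q i) := by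
  rw [isHEI_iff]
  intro M
  rw [Prod.fst_sum, Prod.snd_sum, map_sum, map_sum]
  exact Finset.sum_le_sum fun i hi => (isHEI_iff _).1 (h i hi) M

/-- Each ordered pair of vertices contributes its weight once for every cut separating it; this lets
a contraction of bit strings act pair by pair. -/
theorem HolographicGraph.two_mul_sum_cutArea {R X : Type*} [Fintype X] (M : HolographicGraph R)
    (Y : X → Finset M.V) :
    2 * ∑ s, M.cutArea (Y s) = ∑ p, ∑ q, M.weight p q *
      hammingDist (fun s => decide (p ∈ Y s)) (fun s => decide (q ∈ Y s)) := by
  simp only [Finset.mul_sum, M.two_mul_cutArea]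
  rw [Finset.sum_comm]
  refine Finset.sum_congr rfl fun p _ => ?_
  rw [Finset.sum_comm]
  refine Finset.sum_congr rfl fun q _ => ?_
  rw [← Finset.mul_sum, hammingDist, Finset.natCast_card_filter]

/-- Proof by contraction. -/
theorem isHEI_of_contraction {R S T : Type*} [Fintype S] [Fintype T] [DecidableEq R]
    (L : S → Finset R) (K : T → Finset R) (f : (S → Bool) → T → Bool)
    (hf : ∀ x y, hammingDist (f x) (f y) ≤ hammingDist x y)
    (hbd : ∀ r t, f (fun s => decide (r ∈ L s)) t = decide (r ∈ K t)) :
    IsHEI (∑ s, entropyTerm (L s), ∑ t, entropyTerm (K t)) := by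
  rw [isHEI_iff]
  intro M
  simp only [map_sum, HolographicGraph.evalEntropy_entropyTerm, NNReal.coe_one, one_mul]
  choose W hW hWS using fun s => M.exists_cutArea_eq_entropy (L s)
  let x : M.V → S → Bool := fun p s => decide (p ∈ W s)
  -- Candidate cuts for the right-hand side, cut and pasted from the minimal cuts on the left; `hbd`
  -- makes them homologous to `K t`.
  let U : T → Finset M.V := fun t => Finset.univ.filter fun p => f (x p) t = true
  have hU : ∀ t p, decide (p ∈ U t) = f (x p) t := by simp [U]
  have hUK : ∀ t v r, M.region v = some r → (v ∈ U t ↔ r ∈ K t) := by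
    intro t v r hr
    have hx : x v = fun s => decide (r ∈ L s) := by
      funext s
      simp [x, hW s v r hr]
    simp [U, hx, hbd]
  calc ∑ t, M.entropy (K t) ≤ ∑ t, M.cutArea (U t) :=
        Finset.sum_le_sum fun t _ => M.entropy_le_cutArea (hUK t)
    _ ≤ ∑ s, M.cutArea (W s) := ?_
    _ = ∑ s, M.entropy (L s) := Finset.sum_congr rfl fun s _ => hWS s
  have h1 := M.two_mul_sum_cutArea U
  have h2 := M.two_mul_sum_cutArea W
  simp only [hU] at h1
  have h3 : ∑ p, ∑ q, M.weight p q * hammingDist (f (x p)) (f (x q)) ≤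
      ∑ p, ∑ q, M.weight p q * hammingDist (x p) (x q) :=
    Finset.sum_le_sum fun p _ => Finset.sum_le_sum fun q _ =>
      mul_le_mul_of_nonneg_left (by exact_mod_cast hf _ _) (M.weight_nonneg p q)
  linarith

/-- Walk from `x` to `y` by correcting one coordinate at a time and use the triangle inequality. -/
theorem hammingDist_contraction_of_update {S T : Type*} [Fintype S] [DecidableEq S] [Fintype T]
    (f : (S → Bool) → T → Bool)
    (h : ∀ x s b, hammingDist (f x) (f (Function.update x s b)) ≤ 1) (x y : S → Bool) :
    hammingDist (f x) (f y) ≤ hammingDist x y := by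
  induction hn : hammingDist x y generalizing x with
  | zero => simp [hammingDist_eq_zero.1 hn]
  | succ n ih =>
    obtain ⟨s, hs⟩ : ∃ s, x s ≠ y s := by
      by_contra! hc
      simp [funext hc] at hn
    have hd : hammingDist (Function.update x s (y s)) y = n := by
      have : (Finset.univ.filter fun i => x i ≠ y i) =
          insert s (Finset.univ.filter fun i => Function.update x s (y s) i ≠ y i) := by
        ext i
        by_cases hi : i = s
        · subst hi
          simp [hs]
        · simp [hi]
      unfold hammingDist at hn ⊢
      rw [this, Finset.card_insert_of_notMem (by simp)] at hn
      omega
    have := hammingDist_triangle (f x) (f (Function.update x s (y s))) (f y)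
    have := ih _ hd
    have := h x s (y s)
    omega

theorem eq_zero_or_eq_one_of_zmod_two : ∀ z : ZMod 2, z = 0 ∨ z = 1 := by decide

/-! ### Diagonals of squares on the torus: isotropy and potentials mod 2 -/

section ToricContraction

variable {α β : ℕ}

/-- The sum of `g` over the two ends of one of the two diagonals of the square `t` of the torus. -/
def diagonalSum {K : Type*} [Add K] (g : ZMod α × ZMod β → K) (b : Bool) (t : ZMod α × ZMod β) :
    K :=
  if b then
    g (t.1 + ((α - 1) / 2 : ℕ) + 1, t.2 + ((β - 1) / 2 : ℕ)) +
      g (t.1 + ((α - 1) / 2 : ℕ) + 1, t.2 + ((β - 1) / 2 : ℕ) + 1)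
  else g (t.1, t.2) + g (t.1 + 1, t.2)

theorem half_add_half_add_one (hα : Odd α) :
    (((α - 1) / 2 : ℕ) : ZMod α) + ((α - 1) / 2 : ℕ) + 1 = 0 := by
  have h : (α - 1) / 2 + (α - 1) / 2 + 1 = α := by
    obtain ⟨m, rfl⟩ := hα
    omega
  have := congrArg (Nat.cast : ℕ → ZMod α) h
  simpa using this

/-- The autocorrelation of two functions. -/
def correlation {G K : Type*} [Fintype G] [Add G] [CommRing K] (g g' : G → K) (d : G) : K :=
  ∑ u, g u * g' (u + d)

theorem correlation_neg {G K : Type*} [Fintype G] [AddCommGroup G] [CommRing K] (g g' : G → K)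
    (d : G) : correlation g g' (-d) = correlation g' g d := by
  unfold correlation
  rw [← Equiv.sum_comp (Equiv.addRight d)]
  refine Finset.sum_congr rfl fun u _ => ?_
  simp [mul_comm]

theorem sum_mul_eq_correlation {G K : Type*} [Fintype G] [AddCommGroup G] [CommRing K]
    (g g' : G → K) (c d : G) : ∑ u, g (u + c) * g' (u + d) = correlation g g' (d - c) := by
  unfold correlation
  rw [← Equiv.sum_comp (Equiv.addRight c) (fun u => g u * g' (u + (d - c)))]
  refine Finset.sum_congr rfl fun u _ => ?_
  simp [add_assoc]

variable [NeZero α] [NeZero β]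

/-- The products run over the sides of the squares. With $k=\frac{\alpha-1}2$, $l=\frac{\beta-1}2$
the displacements are $(k\text{ or }k+1,\ l\text{ or }l+1)$. Since $-k=k+1$ and $-l=l+1$, they form
two pairs $\pm d$, so the result is symmetric in `g` and `g'`. -/
theorem sum_diagonalSum_mul {K : Type*} [CommRing K] (hα : Odd α) (hβ : Odd β)
    (g g' : ZMod α × ZMod β → K) :
    ∑ t, diagonalSum g false t * diagonalSum g' true t =
      (correlation g g' (((α - 1) / 2 : ℕ), ((β - 1) / 2 : ℕ)) +
        correlation g' g (((α - 1) / 2 : ℕ), ((β - 1) / 2 : ℕ))) +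
      (correlation g g' (((α - 1) / 2 : ℕ), ((β - 1) / 2 : ℕ) + 1) +
        correlation g' g (((α - 1) / 2 : ℕ), ((β - 1) / 2 : ℕ) + 1)) := by
  have hk := half_add_half_add_one hα
  have hl := half_add_half_add_one hβ
  generalize hk' : (((α - 1) / 2 : ℕ) : ZMod α) = k at *
  generalize hl' : (((β - 1) / 2 : ℕ) : ZMod β) = l at *
  have e1 : -(k, l) = (k + 1, l + 1) := by
    ext
    · exact neg_eq_of_add_eq_zero_right (by simpa [add_assoc] using hk)
    · exact neg_eq_of_add_eq_zero_right (by simpa [add_assoc] using hl)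
  have e2 : -(k, l + 1) = (k + 1, l) := by
    ext
    · exact neg_eq_of_add_eq_zero_right (by simpa [add_assoc] using hk)
    · exact neg_eq_of_add_eq_zero_right (by linear_combination hl)
  rw [← correlation_neg g g', ← correlation_neg g g', e1, e2]
  have s1 := sum_mul_eq_correlation g g' (0, 0) (k + 1, l)
  have s2 := sum_mul_eq_correlation g g' (0, 0) (k + 1, l + 1)
  have s3 := sum_mul_eq_correlation g g' (1, 0) (k + 1, l)
  have s4 := sum_mul_eq_correlation g g' (1, 0) (k + 1, l + 1)
  simp only [Prod.mk_sub_mk, sub_zero, add_sub_cancel_right] at s1 s2 s3 s4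
  rw [← s1, ← s2, ← s3, ← s4, ← Finset.sum_add_distrib, ← Finset.sum_add_distrib,
    ← Finset.sum_add_distrib]
  refine Finset.sum_congr rfl fun t _ => ?_
  obtain ⟨i, j⟩ := t
  simp only [diagonalSum, hk', hl', Prod.mk_add_mk, add_zero, Bool.false_eq_true, if_false, if_true,
    add_assoc]
  ring

theorem sum_diagonalSum_mul_comm {K : Type*} [CommRing K] (hα : Odd α) (hβ : Odd β)
    (g g' : ZMod α × ZMod β → K) :
    ∑ t, diagonalSum g false t * diagonalSum g' true t =
      ∑ t, diagonalSum g true t * diagonalSum g' false t := by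
  simp only [mul_comm (diagonalSum g true _)]
  rw [sum_diagonalSum_mul hα hβ, sum_diagonalSum_mul hα hβ]
  ring

theorem sum_diagonalSum {K : Type*} [CommRing K] (g : ZMod α × ZMod β → K) (b : Bool) :
    ∑ t, diagonalSum g b t = 2 * ∑ t, g t := by
  have h : ∀ d : ZMod α × ZMod β, ∑ t, g (t + d) = ∑ t, g t :=
    fun d => Equiv.sum_comp (Equiv.addRight d) g
  cases b
  · have h1 := h (1, 0)
    simp only [diagonalSum, Bool.false_eq_true, if_false, Finset.sum_add_distrib]
    simp only [Prod.add_def, add_zero] at h1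
    rw [h1, two_mul]
  · simp only [diagonalSum, if_true, Finset.sum_add_distrib]
    have h1 := h (((α - 1) / 2 : ℕ) + 1, ((β - 1) / 2 : ℕ))
    have h2 := h (((α - 1) / 2 : ℕ) + 1, ((β - 1) / 2 : ℕ) + 1)
    simp only [Prod.add_def, ← add_assoc] at h1 h2
    rw [h1, h2, two_mul]

theorem sum_diagonalSum_zmod_two (g : ZMod α × ZMod β → ZMod 2) (b : Bool) :
    ∑ t, diagonalSum g b t = 0 := by
  rw [sum_diagonalSum, show (2 : ZMod 2) = 0 from rfl, zero_mul]

theorem sum_diagonalSum_mul_self (hα : Odd α) (hβ : Odd β) (g : ZMod α × ZMod β → ZMod 2) :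
    ∑ t, diagonalSum g false t * diagonalSum g true t = 0 := by
  rw [sum_diagonalSum_mul hα hβ]
  simp [CharTwo.add_self_eq_zero]

/-- The graph consisting of one diagonal of each square is not bipartite. -/
theorem not_diagonalSum_eq_one (hα : Odd α) (hβ : Odd β) (x : ZMod α × ZMod β → Bool)
    (g : ZMod α × ZMod β → ZMod 2) : ¬ ∀ t, diagonalSum g (x t) t = 1 := by
  intro h
  -- The chosen diagonal makes one factor vanish; expanding the sum instead leaves only
  -- $\alpha\beta$, which is odd.
  have h1 : ∀ t, (1 + diagonalSum g false t) * (1 + diagonalSum g true t) = 0 := by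
    intro t
    have h11 : (1 : ZMod 2) + 1 = 0 := rfl
    have := h t
    cases hx : x t <;> rw [hx] at this <;> rw [this, h11] <;> simp
  have h2 : ∑ t, (1 + diagonalSum g false t) * (1 + diagonalSum g true t) =
      ∑ t : ZMod α × ZMod β, 1 + ∑ t, diagonalSum g false t + ∑ t, diagonalSum g true t +
        ∑ t, diagonalSum g false t * diagonalSum g true t := by
    simp only [← Finset.sum_add_distrib]
    exact Finset.sum_congr rfl fun t _ => by ring
  rw [Finset.sum_congr rfl fun t _ => h1 t, sum_diagonalSum_zmod_two, sum_diagonalSum_zmod_two,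
    sum_diagonalSum_mul_self hα hβ] at h2
  have h3 : ((α * β : ℕ) : ZMod 2) = 1 := ZMod.natCast_eq_one_iff_odd.2 (hα.mul hβ)
  rw [Nat.cast_mul] at h3
  simp [h3] at h2

/-- `diagonalSum` over a choice of one diagonal in each square, as a linear map. -/
def diagonalMap (K : Type*) [CommRing K] (x : ZMod α × ZMod β → Bool) :
    (ZMod α × ZMod β → K) →ₗ[K] (ZMod α × ZMod β → K) where
  toFun g t := diagonalSum g (x t) t
  map_add' g g' := by
    funext t
    simp only [diagonalSum, Pi.add_apply]
    split_ifs <;> ring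
  map_smul' c g := by
    funext t
    simp only [diagonalSum, Pi.smul_apply, smul_eq_mul, RingHom.id_apply]
    split_ifs <;> ring

/-- The coboundary of `g` on the graph consisting of the diagonals `x` is the set of the diagonals of
type `b`. -/
def IsPotential (x : ZMod α × ZMod β → Bool) (b : Bool) (g : ZMod α × ZMod β → ZMod 2) : Prop :=
  ∀ t, diagonalSum g (x t) t = if x t = b then 1 else 0

/-- The `false` diagonals join horizontal neighbours and the `true` ones vertical neighbours, so all
diagonals together connect the torus. -/
theorem eq_const_of_diagonalSum_eq_zero (g : ZMod α × ZMod β → ZMod 2)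
    (h : ∀ b t, diagonalSum g b t = 0) (t : ZMod α × ZMod β) : g t = g 0 := by
  have hh : ∀ i j, g (i + 1, j) = g (i, j) := by
    intro i j
    have := h false (i, j)
    simp only [diagonalSum, Bool.false_eq_true, if_false] at this
    exact (CharTwo.add_eq_zero.1 this).symm
  have hv : ∀ i j, g (i, j + 1) = g (i, j) := by
    intro i j
    have := h true (i - 1 - ((α - 1) / 2 : ℕ), j - ((β - 1) / 2 : ℕ))
    simp only [diagonalSum, if_true, sub_add_cancel] at this
    exact (CharTwo.add_eq_zero.1 this).symm
  have h1 : ∀ (n : ℕ) j, g ((n : ZMod α), j) = g (0, j) := by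
    intro n j
    induction n with
    | zero => simp
    | succ n ih => rw [Nat.cast_succ, hh, ih]
  have h2 : ∀ n : ℕ, g (0, (n : ZMod β)) = g (0, 0) := by
    intro n
    induction n with
    | zero => simp
    | succ n ih => rw [Nat.cast_succ, hv, ih]
  obtain ⟨i, j⟩ := t
  rw [← ZMod.natCast_zmod_val i, h1, ← ZMod.natCast_zmod_val j, h2]
  rfl

theorem diagonalMap_dotProduct_diagonalMap_not (hα : Odd α) (hβ : Odd β)
    (x : ZMod α × ZMod β → Bool) (g : ZMod α × ZMod β → ZMod 2) {g₀ : ZMod α × ZMod β → ZMod 2}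
    (hg₀ : diagonalMap (ZMod 2) x g₀ = 0) :
    ∑ t, diagonalSum g₀ (!x t) t * diagonalSum g (x t) t = 0 := by
  have h : ∀ t, diagonalSum g₀ (!x t) t * diagonalSum g (x t) t =
      diagonalSum g₀ false t * diagonalSum g true t +
        diagonalSum g₀ true t * diagonalSum g false t := by
    intro t
    have := congrFun hg₀ t
    change diagonalSum g₀ (x t) t = 0 at this
    cases hx : x t <;> rw [hx] at this <;> simp [this]
  rw [Finset.sum_congr rfl fun t _ => h t, Finset.sum_add_distrib,
    sum_diagonalSum_mul_comm hα hβ g₀ g, CharTwo.add_self_eq_zero]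

/-- Where `x t ≠ b`, the diagonal sum of `g₀` of type `!b` vanishes by `hg₀`, so the restricted sum
equals the sum over the whole torus. -/
theorem indicator_dotProduct_diagonalMap_not (x : ZMod α × ZMod β → Bool) (b : Bool)
    {g₀ : ZMod α × ZMod β → ZMod 2} (hg₀ : diagonalMap (ZMod 2) x g₀ = 0) :
    ∑ t, diagonalSum g₀ (!x t) t * (if x t = b then 1 else 0) = 0 := by
  refine (Finset.sum_congr rfl fun t _ => ?_).trans (sum_diagonalSum_zmod_two g₀ !b)
  have := congrFun hg₀ t
  change diagonalSum g₀ (x t) t = 0 at this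
  cases hx : x t <;> cases b <;> rw [hx] at this <;> simp [this]

/-- The range of `diagonalMap`, together with the indicator functions of the two types of edges. -/
def potentialMap (x : ZMod α × ZMod β → Bool) :
    (ZMod α × ZMod β → ZMod 2) × (Bool → ZMod 2) →ₗ[ZMod 2] (ZMod α × ZMod β → ZMod 2) :=
  LinearMap.coprod (diagonalMap (ZMod 2) x)
    { toFun := fun c t => c (x t)
      map_add' := fun _ _ => rfl
      map_smul' := fun _ _ => rfl }

omit [NeZero α] [NeZero β] in
theorem potentialMap_apply (x : ZMod α × ZMod β → Bool) (g : ZMod α × ZMod β → ZMod 2)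
    (c : Bool → ZMod 2) (t : ZMod α × ZMod β) :
    potentialMap x (g, c) t = diagonalSum g (x t) t + c (x t) := rfl

theorem finrank_ker_diagonalMap_le (x : ZMod α × ZMod β → Bool) :
    Module.finrank (ZMod 2) (LinearMap.ker (diagonalMap (ZMod 2) x)) ≤
      Module.finrank (ZMod 2) ((LinearMap.ker (diagonalMap (ZMod 2) x)).map
        (diagonalMap (ZMod 2) fun t => !x t)) + 1 := by
  set N := LinearMap.ker (diagonalMap (ZMod 2) x)
  set φ := (diagonalMap (ZMod 2) fun t => !x t).domRestrict N
  have h1 := LinearMap.finrank_range_add_finrank_ker φ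
  have h2 : LinearMap.range φ = N.map (diagonalMap (ZMod 2) fun t => !x t) :=
    LinearMap.range_domRestrict _ _
  have h3 : Module.finrank (ZMod 2) (LinearMap.ker φ) ≤ 1 := by
    let ev : LinearMap.ker φ →ₗ[ZMod 2] ZMod 2 :=
      (LinearMap.proj (0 : ZMod α × ZMod β)).comp (N.subtype.comp (LinearMap.ker φ).subtype)
    have hev : Function.Injective ev := by
      rw [← LinearMap.ker_eq_bot, LinearMap.ker_eq_bot']
      rintro ⟨⟨g, hg⟩, hg'⟩ h0
      change g 0 = 0 at h0
      have hg1 : ∀ t, diagonalSum g (x t) t = 0 := fun t => congrFun hg t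
      have hg2 : ∀ t, diagonalSum g (!x t) t = 0 := fun t => congrFun hg' t
      have : g = 0 := by
        funext t
        rw [eq_const_of_diagonalSum_eq_zero g _ t, h0]
        · rfl
        · intro b t
          by_cases hb : b = x t
          · rw [hb, hg1]
          · rw [Bool.eq_not_of_ne hb, hg2]
      simp [this]
    simpa using LinearMap.finrank_le_finrank_of_injective hev
  rw [← h2]
  omega

/-- A dimension count. The range of `potentialMap x` is orthogonal to the image $W$ of the kernel
$N$ of `diagonalMap` under the complementary map, and $\dim N\le\dim W+1$. The source has dimension
$\alpha\beta+2$, so the kernel of `potentialMap x` exceeds $N$ and contains some `(g, c)` with `c ≠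
0`. -/
theorem exists_isPotential (hα : Odd α) (hβ : Odd β) (x : ZMod α × ZMod β → Bool) :
    (∃ g, IsPotential x false g) ∨ ∃ g, IsPotential x true g := by
  have : Fact (Nat.Prime 2) := ⟨Nat.prime_two⟩
  obtain ⟨g, c, hgc, hc⟩ : ∃ g c, potentialMap x (g, c) = 0 ∧ c ≠ 0 := by
    by_contra! hcon
    set N := LinearMap.ker (diagonalMap (ZMod 2) x) with hN
    set W := N.map (diagonalMap (ZMod 2) fun t => !x t) with hW
    have h1 := finrank_ker_diagonalMap_le x
    rw [← hN, ← hW] at h1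
    have h2 := LinearMap.finrank_range_add_finrank_ker (potentialMap x)
    have h3 : Module.finrank (ZMod 2) (LinearMap.ker (potentialMap x)) ≤
        Module.finrank (ZMod 2) N := by
      let pr : LinearMap.ker (potentialMap x) →ₗ[ZMod 2] N :=
        ((LinearMap.fst _ _ _).comp (LinearMap.ker (potentialMap x)).subtype).codRestrict N <| by
          rintro ⟨⟨g, c⟩, h⟩
          have hc := hcon g c h
          subst hc
          change diagonalMap (ZMod 2) x g = 0
          funext t
          have := congrFun (show potentialMap x (g, 0) = 0 from h) t
          rw [potentialMap_apply] at this
          exact (add_zero _).symm.trans this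
      refine LinearMap.finrank_le_finrank_of_injective (f := pr) ?_
      rw [← LinearMap.ker_eq_bot, LinearMap.ker_eq_bot']
      rintro ⟨⟨g, c⟩, h⟩ h0
      have hc := hcon g c h
      have hg : g = 0 := congrArg Subtype.val h0
      simp [hc, hg]
    have h4 : LinearMap.range (potentialMap x) ≤
        (W.map (dotProductEquiv (ZMod 2) (ZMod α × ZMod β)).toLinearMap).dualCoannihilator := by
      rintro _ ⟨⟨g, c⟩, rfl⟩
      rw [Submodule.mem_dualCoannihilator]
      rintro _ ⟨_, ⟨g₀, hg₀, rfl⟩, rfl⟩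
      have e1 := diagonalMap_dotProduct_diagonalMap_not hα hβ x g hg₀
      have e2 := indicator_dotProduct_diagonalMap_not x false hg₀
      have e3 := indicator_dotProduct_diagonalMap_not x true hg₀
      change ∑ t, diagonalSum g₀ (!x t) t * (diagonalSum g (x t) t + c (x t)) = 0
      have : ∀ t, diagonalSum g₀ (!x t) t * (diagonalSum g (x t) t + c (x t)) =
          diagonalSum g₀ (!x t) t * diagonalSum g (x t) t +
          (c false * (diagonalSum g₀ (!x t) t * (if x t = false then 1 else 0)) +
          c true * (diagonalSum g₀ (!x t) t * (if x t = true then 1 else 0))) := by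
        intro t
        cases x t <;> simp <;> ring
      rw [Finset.sum_congr rfl fun t _ => this t, Finset.sum_add_distrib, Finset.sum_add_distrib,
        ← Finset.mul_sum, ← Finset.mul_sum, e1, e2, e3]
      simp
    have h5 := Submodule.finrank_mono h4
    have h6 := Subspace.finrank_add_finrank_dualCoannihilator_eq
      (W.map (dotProductEquiv (ZMod 2) (ZMod α × ZMod β)).toLinearMap)
    have h7 : Module.finrank (ZMod 2)
        (W.map (dotProductEquiv (ZMod 2) (ZMod α × ZMod β)).toLinearMap) =
        Module.finrank (ZMod 2) W := LinearEquiv.finrank_map_eq _ _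
    have h8 : Module.finrank (ZMod 2) ((ZMod α × ZMod β → ZMod 2) × (Bool → ZMod 2)) =
        Module.finrank (ZMod 2) (ZMod α × ZMod β → ZMod 2) + 2 := by
      simp
    omega
  have h : ∀ t, diagonalSum g (x t) t = c (x t) := fun t =>
    CharTwo.add_eq_zero.1 (congrFun hgc t)
  rcases eq_zero_or_eq_one_of_zmod_two (c false) with hf | hf <;> rcases eq_zero_or_eq_one_of_zmod_two (c true) with ht | ht
  · exact absurd (funext fun b => by cases b <;> simp [hf, ht]) hc
  · refine Or.inr ⟨g, fun t => ?_⟩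
    rw [h]
    cases x t <;> simp [hf, ht]
  · refine Or.inl ⟨g, fun t => ?_⟩
    rw [h]
    cases x t <;> simp [hf, ht]
  -- If `c` is constantly 1, then `g` is a proper 2-colouring of a graph that is never bipartite.
  · refine absurd (fun t => ?_) (not_diagonalSum_eq_one hα hβ x g)
    rw [h]
    cases x t <;> simp [hf, ht]

end ToricContraction

/-! ### Pivots and the contraction property -/

section ToricContraction

variable {α β : ℕ} [NeZero α] [NeZero β]

/-- `v` is the first vertex of the support of some function which changes sign along every edge of
the graph consisting of one diagonal of each square. -/
def IsPivot (x : ZMod α × ZMod β → Bool) (v : ZMod α × ZMod β) : Prop :=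
  ∃ g : ZMod α × ZMod β → ℚ, (∀ t, diagonalSum g (x t) t = 0) ∧ g v ≠ 0 ∧
    ∀ u, Fintype.equivFin _ u < Fintype.equivFin _ v → g u = 0

open Classical in
/-- The contraction map which proves the toric inequality. -/
noncomputable def toricContraction (x : ZMod α × ZMod β → Bool) :
    Option (ZMod α × ZMod β) → Bool
  | none => decide (∃ g, IsPotential x false g)
  | some v => decide (IsPivot x v)

/-- Away from `s` both products vanish, so the global symmetry reduces to its term at `s`: the pairs
of diagonal sums at `s` are proportional. -/
theorem diagonalSum_mul_diagonalSum_comm (hα : Odd α) (hβ : Odd β) (x : ZMod α × ZMod β → Bool)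
    (s : ZMod α × ZMod β) {g g' : ZMod α × ZMod β → ℚ}
    (hg : ∀ t, t ≠ s → diagonalSum g (x t) t = 0) (hg' : ∀ t, t ≠ s → diagonalSum g' (x t) t = 0) :
    diagonalSum g false s * diagonalSum g' true s =
      diagonalSum g true s * diagonalSum g' false s := by
  have h := sum_diagonalSum_mul_comm hα hβ g g'
  rw [← sub_eq_zero, ← Finset.sum_sub_distrib, Finset.sum_eq_single s _ (by simp), sub_eq_zero] at h
  · exact h
  · intro t _ hts
    have h1 := hg t hts
    have h2 := hg' t hts
    cases hx : x t <;> rw [hx] at h1 h2 <;> simp [h1, h2]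

omit [NeZero α] [NeZero β] in
theorem diagonalSum_sub_smul (g g' : ZMod α × ZMod β → ℚ) (c : ℚ) (b : Bool)
    (t : ZMod α × ZMod β) :
    diagonalSum (g - c • g') b t = diagonalSum g b t - c * diagonalSum g' b t := by
  cases b <;> simp [diagonalSum] <;> ring

/-- By proportionality, a multiple of `g'` subtracted from `g` kills both diagonal sums at `s`. As
`g'` starts later than `v`, the first support vertex remains `v`. -/
theorem isPivot_of_two (hα : Odd α) (hβ : Odd β) (x : ZMod α × ZMod β → Bool)
    (s : ZMod α × ZMod β) {g g' : ZMod α × ZMod β → ℚ} {v v' : ZMod α × ZMod β}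
    (hg : ∀ t, t ≠ s → diagonalSum g (x t) t = 0) (hg' : ∀ t, t ≠ s → diagonalSum g' (x t) t = 0)
    (hv : g v ≠ 0) (hgv : ∀ u, Fintype.equivFin _ u < Fintype.equivFin _ v → g u = 0)
    (hgv' : ∀ u, Fintype.equivFin _ u < Fintype.equivFin _ v' → g' u = 0)
    (hlt : Fintype.equivFin _ v < Fintype.equivFin _ v')
    (hs : diagonalSum g' false s ≠ 0 ∨ diagonalSum g' true s ≠ 0)
    {y : ZMod α × ZMod β → Bool} (hy : ∀ t, t ≠ s → y t = x t) : IsPivot y v := by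
  have hc := diagonalSum_mul_diagonalSum_comm hα hβ x s hg hg'
  obtain ⟨c, hcf, hct⟩ : ∃ c : ℚ, diagonalSum g false s = c * diagonalSum g' false s ∧
      diagonalSum g true s = c * diagonalSum g' true s := by
    rcases hs with hs | hs
    · refine ⟨diagonalSum g false s / diagonalSum g' false s, ?_, ?_⟩ <;> field_simp
      linarith
    · refine ⟨diagonalSum g true s / diagonalSum g' true s, ?_, ?_⟩ <;> field_simp
      linarith
  refine ⟨g - c • g', fun t => ?_, ?_, fun u hu => ?_⟩
  · rw [diagonalSum_sub_smul]
    by_cases hts : t = s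
    · subst hts
      cases y t <;> simp [hcf, hct]
    · rw [hy t hts, hg t hts, hg' t hts]
      simp
  · simpa [hgv' v hlt] using hv
  · simp [hgv u hu, hgv' u (hu.trans hlt)]

/-- Changing the diagonal of one square changes at most one pivot. -/
theorem eq_of_isPivot_ne (hα : Odd α) (hβ : Odd β) {x y : ZMod α × ZMod β → Bool}
    {s : ZMod α × ZMod β} (hxy : ∀ t, t ≠ s → x t = y t) {v v' : ZMod α × ZMod β}
    (hv : ¬ (IsPivot x v ↔ IsPivot y v)) (hv' : ¬ (IsPivot x v' ↔ IsPivot y v')) : v = v' := by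
  have main : ∀ v v', ¬ (IsPivot x v ↔ IsPivot y v) → ¬ (IsPivot x v' ↔ IsPivot y v') →
      ¬ Fintype.equivFin _ v < Fintype.equivFin _ v' := by
    intro v v' hv hv' hlt
    -- A witness for the string that has the pivot `w` cannot have both diagonal sums at `s` zero,
    -- or it would serve the other string too.
    have get : ∀ w, ¬ (IsPivot x w ↔ IsPivot y w) → ∃ g : ZMod α × ZMod β → ℚ,
        (∀ t, t ≠ s → diagonalSum g (x t) t = 0) ∧ g w ≠ 0 ∧
        (∀ u, Fintype.equivFin _ u < Fintype.equivFin _ w → g u = 0) ∧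
        (diagonalSum g false s ≠ 0 ∨ diagonalSum g true s ≠ 0) := by
      intro w hw
      obtain ⟨z, z', hz, hz', h, h'⟩ : ∃ z z' : ZMod α × ZMod β → Bool,
          (∀ t, t ≠ s → z t = x t) ∧ (∀ t, t ≠ s → z' t = x t) ∧ IsPivot z w ∧ ¬ IsPivot z' w := by
        by_cases h : IsPivot x w
        · exact ⟨x, y, fun _ _ => rfl, fun t ht => (hxy t ht).symm, h, fun h' => hw (by tauto)⟩
        · exact ⟨y, x, fun t ht => (hxy t ht).symm, fun _ _ => rfl, by tauto, h⟩
      obtain ⟨g, hg, hgw, hgu⟩ := h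
      refine ⟨g, fun t ht => hz t ht ▸ hg t, hgw, hgu, ?_⟩
      by_contra! hcon
      refine h' ⟨g, fun t => ?_, hgw, hgu⟩
      by_cases hts : t = s
      · subst hts
        cases z' t
        exacts [hcon.1, hcon.2]
      · rw [hz' t hts, ← hz t hts]
        exact hg t
    obtain ⟨g, hg, hgv, hgu, -⟩ := get v hv
    obtain ⟨g', hg', -, hgu', hs⟩ := get v' hv'
    have h1 := isPivot_of_two hα hβ x s hg hg' hgv hgu hgu' hlt hs (y := x) fun _ _ => rfl
    have h2 := isPivot_of_two hα hβ x s hg hg' hgv hgu hgu' hlt hs (y := y)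
      fun t ht => (hxy t ht).symm
    exact hv (iff_of_true h1 h2)
  rcases lt_trichotomy (Fintype.equivFin _ v) (Fintype.equivFin _ v') with h | h | h
  · exact absurd h (main _ _ hv hv')
  · exact (Fintype.equivFin _).injective h
  · exact absurd h (main _ _ hv' hv)

/-- The character of `ZMod 2`. -/
def signOf (a : ZMod 2) : ℚ := if a = 0 then 1 else -1

theorem signOf_add_signOf_eq_zero_iff : ∀ a b : ZMod 2, signOf a + signOf b = 0 ↔ a + b = 1 := by
  intro a b
  have h11 : (1 : ZMod 2) + 1 = 0 := rfl
  rcases eq_zero_or_eq_one_of_zmod_two a with rfl | rfl <;> rcases eq_zero_or_eq_one_of_zmod_two b with rfl | rfl <;> norm_num [signOf, h11, show (2 : ZMod 2) ≠ 1 by decide]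

omit [NeZero α] [NeZero β] in
theorem diagonalSum_signOf_eq_zero_iff (g : ZMod α × ZMod β → ZMod 2) (b : Bool)
    (t : ZMod α × ZMod β) :
    diagonalSum (fun v => signOf (g v)) b t = 0 ↔ diagonalSum g b t = 1 := by
  cases b <;> simp [diagonalSum, signOf_add_signOf_eq_zero_iff]

/-- If changing the diagonal of one square changes the type of the odd cycles, then it does not
change the pivots. -/
theorem isPivot_iff_of_isPotential (hα : Odd α) (hβ : Odd β) {x y : ZMod α × ZMod β → Bool}
    {s : ZMod α × ZMod β} (hxy : ∀ t, t ≠ s → x t = y t) (hs : x s ≠ y s)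
    {ε ε' : ZMod α × ZMod β → ZMod 2} (hε : IsPotential x false ε) (hε' : IsPotential y true ε')
    (v : ZMod α × ZMod β) : IsPivot x v ↔ IsPivot y v := by
  -- Off `s` each chosen edge is counted by exactly one of `ε`, `ε'`, so `g` changes sign along it.
  -- At `s` it cannot do so along either diagonal, by non-bipartiteness.
  let g : ZMod α × ZMod β → ℚ := fun v => signOf ((ε + ε') v)
  have hadd : ∀ b t, diagonalSum (ε + ε') b t = diagonalSum ε b t + diagonalSum ε' b t := by
    intro b t
    cases b <;> simp [diagonalSum] <;> ring
  have hoff : ∀ t, t ≠ s → diagonalSum (ε + ε') (x t) t = 1 := by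
    intro t ht
    have h1 := hε t
    have h2 := hε' t
    rw [← hxy t ht] at h2
    rw [hadd, h1, h2]
    cases x t <;> simp
  have hg : ∀ t, t ≠ s → diagonalSum g (x t) t = 0 := fun t ht =>
    (diagonalSum_signOf_eq_zero_iff _ _ _).2 (hoff t ht)
  have hgx : diagonalSum g (x s) s ≠ 0 := by
    intro h0
    refine not_diagonalSum_eq_one hα hβ x (ε + ε') fun t => ?_
    by_cases hts : t = s
    · subst hts
      exact (diagonalSum_signOf_eq_zero_iff _ _ _).1 h0
    · exact hoff t hts
  have hgy : diagonalSum g (y s) s ≠ 0 := by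
    intro h0
    refine not_diagonalSum_eq_one hα hβ y (ε + ε') fun t => ?_
    by_cases hts : t = s
    · subst hts
      exact (diagonalSum_signOf_eq_zero_iff _ _ _).1 h0
    · rw [← hxy t hts]
      exact hoff t hts
  have hgf : ∀ b, diagonalSum g b s ≠ 0 := by
    intro b
    by_cases hb : b = x s
    · rwa [hb]
    · have : b = y s := by
        cases hx : x s <;> cases hy : y s <;> cases b <;> simp_all
      rwa [this]
  -- The pair of diagonal sums of `f` at `s` is proportional to that of `g`, whose entries are both
  -- nonzero.
  have hiff : ∀ f : ZMod α × ZMod β → ℚ, (∀ t, t ≠ s → diagonalSum f (x t) t = 0) →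
      (diagonalSum f false s = 0 ↔ diagonalSum f true s = 0) := by
    intro f hf
    have h := diagonalSum_mul_diagonalSum_comm hα hβ x s hf hg
    constructor
    · intro h0
      rw [h0, zero_mul] at h
      exact (mul_eq_zero.1 h.symm).resolve_right (hgf _)
    · intro h0
      rw [h0, zero_mul] at h
      exact (mul_eq_zero.1 h).resolve_right (hgf _)
  have hker : ∀ f : ZMod α × ZMod β → ℚ,
      (∀ t, diagonalSum f (x t) t = 0) ↔ ∀ t, diagonalSum f (y t) t = 0 := by
    intro f
    constructor
    · intro hf t
      by_cases hts : t = s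
      · subst hts
        have h1 := hiff f fun t _ => hf t
        have h2 := hf t
        cases hx : x t <;> cases hy : y t <;> simp_all
      · rw [← hxy t hts]
        exact hf t
    · intro hf t
      by_cases hts : t = s
      · subst hts
        have h1 := hiff f fun u hu => hxy u hu ▸ hf u
        have h2 := hf t
        cases hx : x t <;> cases hy : y t <;> simp_all
      · rw [hxy t hts]
        exact hf t
  simp only [IsPivot, hker]

theorem hammingDist_toricContraction_update_le (hα : Odd α) (hβ : Odd β)
    (x : ZMod α × ZMod β → Bool) (s : ZMod α × ZMod β) (b : Bool) :
    hammingDist (toricContraction x) (toricContraction (Function.update x s b)) ≤ 1 := by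
  by_cases hb : x s = b
  · simp [← hb]
  set y := Function.update x s b with hy
  have hxy : ∀ t, t ≠ s → x t = y t := fun t ht => by simp [hy, ht]
  have hs : x s ≠ y s := by simpa [hy] using hb
  have hmix : ¬ ((∃ g, IsPotential x false g) ↔ ∃ g, IsPotential y false g) →
      ∀ v, IsPivot x v ↔ IsPivot y v := by
    intro h v
    by_cases hx : ∃ g, IsPotential x false g
    · have hyf : ¬ ∃ g, IsPotential y false g := fun hyf => h (iff_of_true hx hyf)
      obtain ⟨ε, hε⟩ := hx
      obtain ⟨ε', hε'⟩ := (exists_isPotential hα hβ y).resolve_left hyf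
      exact isPivot_iff_of_isPotential hα hβ hxy hs hε hε' v
    · have hyf : ∃ g, IsPotential y false g := by tauto
      obtain ⟨ε, hε⟩ := hyf
      obtain ⟨ε', hε'⟩ := (exists_isPotential hα hβ x).resolve_left hx
      exact (isPivot_iff_of_isPotential hα hβ (fun t ht => (hxy t ht).symm) hs.symm hε hε' v).symm
  unfold hammingDist
  rw [Finset.card_le_one]
  intro i hi i' hi'
  replace hi := (Finset.mem_filter.1 hi).2
  replace hi' := (Finset.mem_filter.1 hi').2
  rcases i with _ | v <;> rcases i' with _ | v' <;>
    simp only [toricContraction, ne_eq, decide_eq_decide] at hi hi'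
  · rfl
  · exact absurd (hmix hi v') hi'
  · exact absurd (hmix hi' v) hi
  · rw [eq_of_isPivot_ne hα hβ hxy hi hi']

theorem hammingDist_toricContraction_le (hα : Odd α) (hβ : Odd β)
    (x y : ZMod α × ZMod β → Bool) :
    hammingDist (toricContraction x) (toricContraction y) ≤ hammingDist x y :=
  hammingDist_contraction_of_update _ (hammingDist_toricContraction_update_le hα hβ) x y

end ToricContraction

/-! ### Boundary conditions of the contraction -/

theorem ZMod.val_sub_natCast_eq_ite {n : ℕ} [NeZero n] (c : ZMod n) {m : ℕ} (hm : m ≤ n) :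
    (c - (m : ZMod n)).val = if m ≤ c.val then c.val - m else c.val + n - m := by
  have hc := ZMod.val_lt c
  split_ifs with h
  · have : c - (m : ZMod n) = ((c.val - m : ℕ) : ZMod n) := by
      rw [Nat.cast_sub h, ZMod.natCast_zmod_val]
    rw [this, ZMod.val_natCast, Nat.mod_eq_of_lt (by omega)]
  · have : c - (m : ZMod n) = ((c.val + n - m : ℕ) : ZMod n) := by
      rw [Nat.cast_sub (by omega), Nat.cast_add, ZMod.natCast_zmod_val, ZMod.natCast_self, add_zero]
    rw [this, ZMod.val_natCast, Nat.mod_eq_of_lt (by omega)]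

theorem eq_zero_of_add_succ_eq_zero {n : ℕ} [NeZero n] (hn : Odd n) (h : ZMod n → ℚ)
    (hh : ∀ j, h j + h (j + 1) = 0) (j : ZMod n) : h j = 0 := by
  have h1 : ∀ m : ℕ, h (j + m) = (-1) ^ m * h j := by
    intro m
    induction m with
    | zero => simp
    | succ m ih =>
      rw [Nat.cast_succ, ← add_assoc, pow_succ]
      linarith [hh (j + m)]
  have h2 := h1 n
  rw [ZMod.natCast_self, add_zero, hn.neg_one_pow] at h2
  linarith

section ToricBoundary

variable {α β : ℕ} [NeZero α] [NeZero β]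

/-- When the admissible functions are exactly those supported in `P`, the indicator of a single
vertex of `P` is a witness. -/
theorem isPivot_iff_mem {x : ZMod α × ZMod β → Bool} {P : Set (ZMod α × ZMod β)}
    (hP : ∀ g : ZMod α × ZMod β → ℚ, (∀ v, v ∉ P → g v = 0) → ∀ t, diagonalSum g (x t) t = 0)
    (hg : ∀ g : ZMod α × ZMod β → ℚ, (∀ t, diagonalSum g (x t) t = 0) → ∀ v, v ∉ P → g v = 0)
    (v : ZMod α × ZMod β) : IsPivot x v ↔ v ∈ P := by
  constructor
  · rintro ⟨g, h, hv, -⟩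
    by_contra hvP
    exact hv (hg g h v hvP)
  · intro hv
    refine ⟨Pi.single v 1, hP _ fun u hu => ?_, by simp, fun u hu => ?_⟩
    · exact Pi.single_eq_of_ne (by rintro rfl; exact hu hv) _
    · exact Pi.single_eq_of_ne (by rintro rfl; exact lt_irrefl _ hu) _

/-- The vertices on the right meet no chosen diagonal. Every other vertex lies on a vertical cycle
of `true` diagonals of odd length $\beta$, where alternating functions vanish. -/
theorem isPivot_of_first_iff (hα : Odd α) (hβ : Odd β) (l : ZMod α) (v : ZMod α × ZMod β) :
    IsPivot (fun t : ZMod α × ZMod β => decide ((l - t.1).val < (α + 1) / 2)) v ↔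
      (l - v.1).val < (α - 1) / 2 := by
  have hk : 2 * ((α - 1) / 2) + 1 = α := by
    obtain ⟨m, rfl⟩ := hα
    omega
  have hk0 := half_add_half_add_one hα
  have hd := fun i : ZMod α => ZMod.val_lt (l - i)
  refine isPivot_iff_mem (P := {v | (l - v.1).val < (α - 1) / 2}) (fun g hg t => ?_)
    (fun g hg v hv => ?_) v
  · simp only [Set.mem_ofPred_eq] at hg
    have hdt := hd t.1
    by_cases ht : (l - t.1).val < (α + 1) / 2
    · have h1 : ¬ (l - (t.1 + ((α - 1) / 2 : ℕ) + 1)).val < (α - 1) / 2 := by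
        have := ZMod.val_sub_natCast_eq_ite (l - t.1) (m := (α - 1) / 2 + 1) (by omega)
        rw [Nat.cast_succ, sub_sub, ← add_assoc] at this
        rw [this]
        split_ifs <;> omega
      simp [ht, diagonalSum, hg, h1]
    · have h1 : ¬ (l - t.1).val < (α - 1) / 2 := by omega
      have h2 : ¬ (l - (t.1 + 1)).val < (α - 1) / 2 := by
        have := ZMod.val_sub_natCast_eq_ite (l - t.1) (m := 1) (by omega)
        rw [Nat.cast_one, sub_sub] at this
        rw [this]
        split_ifs <;> omega
      simp [ht, diagonalSum, hg, h1, h2]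
  · simp only [Set.mem_ofPred_eq] at hv
    obtain ⟨i, j⟩ := v
    refine eq_zero_of_add_succ_eq_zero hβ (fun j => g (i, j)) (fun j => ?_) j
    have ht := hg (i - ((α - 1) / 2 : ℕ) - 1, j - ((β - 1) / 2 : ℕ))
    have hx : (l - (i - ((α - 1) / 2 : ℕ) - 1)).val < (α + 1) / 2 := by
      have := ZMod.val_sub_natCast_eq_ite (l - i) (m := (α - 1) / 2) (by omega)
      have e : l - (i - ((α - 1) / 2 : ℕ) - 1) = l - i - ((α - 1) / 2 : ℕ) := by
        linear_combination hk0
      have := hd i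
      rw [e]
      simp only at hv
      split_ifs at * <;> omega
    simp only [hx, decide_true, diagonalSum, if_true, sub_add_cancel] at ht
    have e : i - (((α - 1) / 2 : ℕ) : ZMod α) - 1 + ((α - 1) / 2 : ℕ) + 1 = i := by ring
    rwa [e] at ht

/-- As before, with horizontal cycles of `false` diagonals of odd length $\alpha$. -/
theorem isPivot_of_second_iff (hα : Odd α) (hβ : Odd β) (m : ZMod β) (v : ZMod α × ZMod β) :
    IsPivot (fun t : ZMod α × ZMod β => decide ((m - t.2).val < (β - 1) / 2)) v ↔
      (m - v.2).val < (β - 1) / 2 := by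
  have hk : 2 * ((β - 1) / 2) + 1 = β := by
    obtain ⟨m, rfl⟩ := hβ
    omega
  have hd := fun i : ZMod β => ZMod.val_lt (m - i)
  refine isPivot_iff_mem (P := {v | (m - v.2).val < (β - 1) / 2}) (fun g hg t => ?_)
    (fun g hg v hv => ?_) v
  · simp only [Set.mem_ofPred_eq] at hg
    have hdt := hd t.2
    by_cases ht : (m - t.2).val < (β - 1) / 2
    · have h1 : ¬ (m - (t.2 + ((β - 1) / 2 : ℕ) + 1)).val < (β - 1) / 2 := by
        have := ZMod.val_sub_natCast_eq_ite (m - t.2) (m := (β - 1) / 2 + 1) (by omega)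
        rw [Nat.cast_succ, sub_sub, ← add_assoc] at this
        rw [this]
        split_ifs <;> omega
      have h2 : ¬ (m - (t.2 + ((β - 1) / 2 : ℕ))).val < (β - 1) / 2 := by
        have := ZMod.val_sub_natCast_eq_ite (m - t.2) (m := (β - 1) / 2) (by omega)
        rw [sub_sub] at this
        rw [this]
        split_ifs <;> omega
      simp [ht, diagonalSum, hg, h1, h2]
    · simp [ht, diagonalSum, hg]
  · simp only [Set.mem_ofPred_eq] at hv
    obtain ⟨i, j⟩ := v
    refine eq_zero_of_add_succ_eq_zero hα (fun i => g (i, j)) (fun i => ?_) i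
    have ht := hg (i, j)
    simpa [hv, diagonalSum] using ht

omit [NeZero β] in
theorem exists_isPotential_of_first (hα : Odd α) (l : ZMod α) :
    ∃ g, IsPotential (fun t : ZMod α × ZMod β => decide ((l - t.1).val < (α + 1) / 2)) false g := by
  have hk : 2 * ((α - 1) / 2) + 1 = α := by
    obtain ⟨m, rfl⟩ := hα
    omega
  -- Vertical edges preserve this parity. A chosen horizontal edge starts at a positive value, so it
  -- lowers the value by one without wrapping around.
  refine ⟨fun v => ((l - v.1).val : ZMod 2), fun t => ?_⟩
  by_cases ht : (l - t.1).val < (α + 1) / 2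
  · simp [ht, diagonalSum, CharTwo.add_self_eq_zero]
  · have h1 := ZMod.val_sub_natCast_eq_ite (l - t.1) (m := 1) (by omega)
    rw [if_pos (by omega), Nat.cast_one, sub_sub] at h1
    simp only [ht, decide_false, diagonalSum, Bool.false_eq_true, if_false, if_true]
    rw [h1, ← Nat.cast_add]
    exact ZMod.natCast_eq_one_iff_odd.2 ⟨(l - t.1).val - 1, by omega⟩

theorem not_exists_isPotential_of_second (hα : Odd α) (hβ : Odd β) (m : ZMod β) :
    ¬ ∃ g, IsPotential (fun t : ZMod α × ZMod β => decide ((m - t.2).val < (β - 1) / 2))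
      false g := by
  rintro ⟨g, hg⟩
  have hk : (β - 1) / 2 < β := by
    obtain ⟨m, rfl⟩ := hβ
    omega
  -- In this row every chosen diagonal is `false`: a closed cycle with $\alpha$, an odd number, of
  -- `false` edges.
  set j : ZMod β := m - ((β - 1) / 2 : ℕ)
  have hj : ¬ (m - j).val < (β - 1) / 2 := by
    have : m - j = ((β - 1) / 2 : ℕ) := by simp [j]
    rw [this, ZMod.val_natCast, Nat.mod_eq_of_lt hk]
    exact lt_irrefl _
  have h1 : ∀ i, g (i, j) + g (i + 1, j) = 1 := by
    intro i
    simpa [hj, diagonalSum] using hg (i, j)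
  have h2 : ∑ i, (g (i, j) + g (i + 1, j)) = 0 := by
    have h3 : ∑ i, g (i + 1, j) = ∑ i, g (i, j) :=
      Equiv.sum_comp (Equiv.addRight (1 : ZMod α)) fun i => g (i, j)
    rw [Finset.sum_add_distrib, h3]
    exact CharTwo.add_self_eq_zero _
  rw [Finset.sum_congr rfl fun i _ => h1 i] at h2
  have h3 : (α : ZMod 2) = 1 := ZMod.natCast_eq_one_iff_odd.2 hα
  simp [h3] at h2

variable {R : Type*} [DecidableEq R]

theorem mem_consecutive_iff {a : ZMod α → Finset R} {r : R} {l : ZMod α}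
    (hr : ∀ i, r ∈ a i ↔ i = l) {k : ℕ} (i : ZMod α) :
    r ∈ consecutive a k i ↔ (l - i).val < k := by
  simp only [consecutive, Finset.mem_biUnion, Finset.mem_range, hr]
  constructor
  · rintro ⟨m, hm, rfl⟩
    rw [add_sub_cancel_left, ZMod.val_natCast]
    exact (Nat.mod_le _ _).trans_lt hm
  · intro h
    exact ⟨_, h, by simp⟩

omit [NeZero α] in
theorem notMem_consecutive {a : ZMod α → Finset R} {r : R} (hr : ∀ i, r ∉ a i) (k : ℕ)
    (i : ZMod α) : r ∉ consecutive a k i := by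
  simp [consecutive, hr]

/-- The toric inequalities are holographic entropy inequalities. -/
theorem isHEI_toricInequality (hα : Odd α) (hβ : Odd β) {a : ZMod α → Finset R}
    {b : ZMod β → Finset R} (hab : IsBoundaryPartition a b) : IsHEI (toricInequality a b) := by
  let K : Option (ZMod α × ZMod β) → Finset R := fun v =>
    v.elim (Finset.univ.biUnion a) fun v => minusRegion a v.1 ∪ minusRegion b v.2
  have h := isHEI_of_contraction
    (fun t : ZMod α × ZMod β => plusRegion a t.1 ∪ minusRegion b t.2) K toricContraction
    (hammingDist_toricContraction_le hα hβ) ?_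
  · simpa only [toricInequality, Fintype.sum_prod_type, Fintype.sum_option, K, Option.elim,
      add_comm] using h
  intro r
  have hα1 : (α + 1) / 2 ≤ α := by have := NeZero.pos α; omega
  have hα2 : (α - 1) / 2 ≤ α := by omega
  have hβ2 : (β - 1) / 2 ≤ β := by omega
  obtain ⟨x, hx, huniq⟩ := hab.2.2 r
  rcases x with l | m
  · have ha : ∀ i, r ∈ a i ↔ i = l := fun i =>
      ⟨fun hi => Sum.inl_injective (huniq (Sum.inl i) hi), fun hi => hi ▸ hx⟩
    have hb : ∀ j, r ∉ b j := fun j hj => Sum.inr_ne_inl (huniq (Sum.inr j) hj)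
    have hL : (fun t : ZMod α × ZMod β => decide (r ∈ plusRegion a t.1 ∪ minusRegion b t.2)) =
        fun t => decide ((l - t.1).val < (α + 1) / 2) := by
      funext t
      simp [plusRegion, minusRegion, mem_consecutive_iff ha, notMem_consecutive hb]
    rw [hL]
    rintro (_ | v)
    · simp [toricContraction, exists_isPotential_of_first hα, K, ha]
    · simp [toricContraction, isPivot_of_first_iff hα hβ, K, minusRegion,
        mem_consecutive_iff ha, notMem_consecutive hb]
  · have hb : ∀ j, r ∈ b j ↔ j = m := fun j =>
      ⟨fun hj => Sum.inr_injective (huniq (Sum.inr j) hj), fun hj => hj ▸ hx⟩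
    have ha : ∀ i, r ∉ a i := fun i hi => Sum.inl_ne_inr (huniq (Sum.inl i) hi)
    have hL : (fun t : ZMod α × ZMod β => decide (r ∈ plusRegion a t.1 ∪ minusRegion b t.2)) =
        fun t => decide ((m - t.2).val < (β - 1) / 2) := by
      funext t
      simp [plusRegion, minusRegion, mem_consecutive_iff hb, notMem_consecutive ha]
    rw [hL]
    rintro (_ | v)
    · have := not_exists_isPotential_of_second hα hβ m
      simp only [toricContraction, this, K, Option.elim, decide_false]
      simp [ha]
    · simp [toricContraction, isPivot_of_second_iff hα hβ, K, minusRegion,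
        mem_consecutive_iff hb, notMem_consecutive ha]

end ToricBoundary

/-! ### Decomposition into tori -/

section Tori

variable {α β nα nβ : ℕ}

theorem multiCycleGraph_adj {n : ℕ} {u v : Fin n → ZMod α} :
    (multiCycleGraph α n).Adj u v ↔ u ≠ v ∧
      ((∀ s, u s - v s = (((α - 1) / 2 : ℕ) : ZMod α)) ∨
        ∀ s, v s - u s = (((α - 1) / 2 : ℕ) : ZMod α)) := by
  simp [multiCycleGraph, SimpleGraph.fromRel_adj]

theorem multiCycleGraph_reachable_add [NeZero α] {n : ℕ} (hα : Odd α) (u : Fin n → ZMod α)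
    (c : ZMod α) : (multiCycleGraph α n).Reachable u fun s => u s + c := by
  have hk := half_add_half_add_one hα
  have step : ∀ m : ℕ,
      (multiCycleGraph α n).Reachable u fun s => u s + m * ((α - 1) / 2 : ℕ) := by
    intro m
    induction m with
    | zero => simp
    | succ m ih =>
      refine ih.trans ?_
      by_cases h : (fun s => u s + (m : ZMod α) * ((α - 1) / 2 : ℕ)) =
          fun s => u s + ((m + 1 : ℕ) : ZMod α) * ((α - 1) / 2 : ℕ)
      · rw [h]
      · refine SimpleGraph.Adj.reachable (multiCycleGraph_adj.2 ⟨h, Or.inr fun s => ?_⟩)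
        push_cast
        ring
  -- Modulo $\alpha$, $-2$ is the inverse of $\frac{\alpha-1}2$.
  have h := step (-2 * c).val
  rw [ZMod.natCast_zmod_val] at h
  convert h using 3
  linear_combination c * hk

/-- The vertex obtained from `u` by shifting all indices of the first kind by `p.1` and all indices
of the second kind by `p.2`. -/
def torusShift (u : MultiIndex α β nα nβ) (p : ZMod α × ZMod β) : MultiIndex α β nα nβ :=
  (fun s => u.1 s + p.1, fun t => u.2 t + p.2)

theorem torusShift_injective (hnα : 1 ≤ nα) (hnβ : 1 ≤ nβ) (u : MultiIndex α β nα nβ) :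
    Function.Injective (torusShift u) := by
  intro p q h
  ext
  · exact add_left_cancel (congrFun (congrArg Prod.fst h) ⟨0, hnα⟩)
  · exact add_left_cancel (congrFun (congrArg Prod.snd h) ⟨0, hnβ⟩)

theorem torusGraph_reachable_iff [NeZero α] [NeZero β] (hα : Odd α) (hβ : Odd β)
    (u v : MultiIndex α β nα nβ) :
    (torusGraph α β nα nβ).Reachable u v ↔ ∃ p, torusShift u p = v := by
  constructor
  · rw [SimpleGraph.reachable_iff_reflTransGen]
    intro h
    induction h with
    | refl => exact ⟨0, by simp [torusShift]⟩
    | @tail v w _ h ih =>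
      obtain ⟨p, rfl⟩ := ih
      have key : ∀ {γ n : ℕ} {x y : Fin n → ZMod γ}, (multiCycleGraph γ n).Adj x y →
          ∃ c, ∀ s, x s + c = y s := by
        intro γ n x y hxy
        rcases (multiCycleGraph_adj.1 hxy).2 with h | h
        · exact ⟨-((γ - 1) / 2 : ℕ), fun s => by rw [← h s]; ring⟩
        · exact ⟨((γ - 1) / 2 : ℕ), fun s => by rw [← h s]; ring⟩
      rcases SimpleGraph.boxProd_adj.1 h with ⟨h1, h2⟩ | ⟨h1, h2⟩
      · obtain ⟨c, hc⟩ := key h1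
        refine ⟨(p.1 + c, p.2), Prod.ext (funext fun s => ?_) h2⟩
        simpa [torusShift, add_assoc] using hc s
      · obtain ⟨c, hc⟩ := key h1
        refine ⟨(p.1, p.2 + c), Prod.ext h2 (funext fun s => ?_)⟩
        simpa [torusShift, add_assoc] using hc s
  · rintro ⟨p, rfl⟩
    exact SimpleGraph.reachable_boxProd.2
      ⟨multiCycleGraph_reachable_add hα u.1 p.1, multiCycleGraph_reachable_add hβ u.2 p.2⟩

theorem multiCycleGraph_adj_add {n : ℕ} (hn : 1 ≤ n) (u : Fin n → ZMod α) (c d : ZMod α) :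
    (multiCycleGraph α n).Adj (fun s => u s + c) (fun s => u s + d) ↔
      c ≠ d ∧ (c - d = ((α - 1) / 2 : ℕ) ∨ d - c = ((α - 1) / 2 : ℕ)) := by
  have : Nonempty (Fin n) := ⟨⟨0, hn⟩⟩
  rw [multiCycleGraph_adj]
  simp [funext_iff]

theorem cycleGraph_adj_iff_sub_eq_one [NeZero α] {c d : ZMod α} (e : ZMod α ≃ Fin α)
    (he : ∀ c d, e (c - d) = e c - e d) (he1 : ∀ c, (e c : ℕ) = c.val) :
    (SimpleGraph.cycleGraph α).Adj (e c) (e d) ↔ c ≠ d ∧ (c - d = 1 ∨ d - c = 1) := by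
  -- The clause `c ≠ 0` matters only for $\alpha=1$, where $1=0$ and there is no edge.
  have hval : ∀ c : ZMod α, c.val = 1 ↔ c ≠ 0 ∧ c = 1 := by
    intro c
    rcases eq_or_ne α 1 with rfl | h1
    · have := ZMod.val_lt c
      have h0 : c = 0 := Subsingleton.elim _ _
      constructor
      · omega
      · exact fun h => absurd h0 h.1
    · have : Fact (1 < α) := ⟨by have := NeZero.pos α; omega⟩
      constructor
      · intro h
        have hc : c = 1 := by rw [← ZMod.natCast_zmod_val c, h, Nat.cast_one]
        exact ⟨hc ▸ one_ne_zero, hc⟩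
      · rintro ⟨-, rfl⟩
        exact ZMod.val_one α
  rw [SimpleGraph.cycleGraph_adj', ← he, ← he, he1, he1, hval, hval, sub_ne_zero, sub_ne_zero]
  tauto

theorem exists_equiv_fin_cycleGraph_adj [NeZero α] (hα : Odd α) :
    ∃ e : ZMod α ≃ Fin α, ∀ c d, (SimpleGraph.cycleGraph α).Adj (e c) (e d) ↔
      c ≠ d ∧ (c - d = ((α - 1) / 2 : ℕ) ∨ d - c = ((α - 1) / 2 : ℕ)) := by
  obtain ⟨e, he, he1⟩ : ∃ e : ZMod α ≃ Fin α, (∀ c d, e (c - d) = e c - e d) ∧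
      ∀ c, (e c : ℕ) = c.val := by
    cases α with
    | zero => exact absurd hα (by decide)
    | succ m => exact ⟨Equiv.refl _, fun _ _ => rfl, fun _ => rfl⟩
  have hk := half_add_half_add_one hα
  -- Multiplication by $-2$ turns steps of $\frac{\alpha-1}2$ into unit steps.
  let f : ZMod α ≃ ZMod α :=
    { toFun := fun c => -2 * c
      invFun := fun c => ((α - 1) / 2 : ℕ) * c
      left_inv := fun c => by linear_combination -c * hk
      right_inv := fun c => by linear_combination -c * hk }
  refine ⟨f.trans e, fun c d => ?_⟩
  have h1 : ∀ c d, f c - f d = 1 ↔ c - d = ((α - 1) / 2 : ℕ) := by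
    intro c d
    change -2 * c - -2 * d = 1 ↔ _
    constructor
    · intro h
      linear_combination ((α - 1) / 2 : ℕ) * h + (c - d) * hk
    · intro h
      linear_combination -2 * h - hk
  rw [Equiv.trans_apply, Equiv.trans_apply, cycleGraph_adj_iff_sub_eq_one e he he1, h1, h1,
    f.injective.ne_iff]

variable [NeZero α] [NeZero β]

theorem mem_supp_iff_exists_torusShift (hα : Odd α) (hβ : Odd β) (τ : Torus α β nα nβ)
    (v : MultiIndex α β nα nβ) : v ∈ τ.supp ↔ ∃ p, torusShift τ.out p = v := by
  rw [← torusGraph_reachable_iff hα hβ, SimpleGraph.ConnectedComponent.mem_supp_iff,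
    ← SimpleGraph.ConnectedComponent.eq]
  have : (torusGraph α β nα nβ).connectedComponentMk τ.out = τ := Quot.out_eq τ
  rw [this]
  exact eq_comm

theorem nonempty_torus_iso (hα : Odd α) (hβ : Odd β) (hnα : 1 ≤ nα) (hnβ : 1 ≤ nβ)
    (τ : Torus α β nα nβ) : Nonempty (τ.toSimpleGraph ≃g
      (SimpleGraph.cycleGraph α).boxProd (SimpleGraph.cycleGraph β)) := by
  obtain ⟨e, he⟩ := exists_equiv_fin_cycleGraph_adj hα
  obtain ⟨f, hf⟩ := exists_equiv_fin_cycleGraph_adj hβ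
  let g : ZMod α × ZMod β → τ.supp := fun p =>
    ⟨torusShift τ.out p, (mem_supp_iff_exists_torusShift hα hβ τ _).2 ⟨p, rfl⟩⟩
  have hg : Function.Bijective g := by
    constructor
    · intro p q h
      exact torusShift_injective hnα hnβ _ (congrArg Subtype.val h)
    · rintro ⟨v, hv⟩
      obtain ⟨p, hp⟩ := (mem_supp_iff_exists_torusShift hα hβ τ _).1 hv
      exact ⟨p, Subtype.ext hp⟩
  let G : ((SimpleGraph.cycleGraph α).boxProd (SimpleGraph.cycleGraph β)) ≃g τ.toSimpleGraph :=
    { toEquiv := (e.prodCongr f).symm.trans (Equiv.ofBijective g hg)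
      map_rel_iff' := by
        intro x y
        obtain ⟨⟨p₁, p₂⟩, rfl⟩ := (e.prodCongr f).surjective x
        obtain ⟨⟨q₁, q₂⟩, rfl⟩ := (e.prodCongr f).surjective y
        simp only [Equiv.trans_apply, Equiv.symm_apply_apply]
        change ((multiCycleGraph α nα).boxProd (multiCycleGraph β nβ)).Adj
          (torusShift τ.out (p₁, p₂)) (torusShift τ.out (q₁, q₂)) ↔ _
        rw [SimpleGraph.boxProd_adj, SimpleGraph.boxProd_adj]
        simp only [torusShift, multiCycleGraph_adj_add hnα, multiCycleGraph_adj_add hnβ,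
          Equiv.prodCongr_apply, Prod.map_apply, he, hf, e.injective.eq_iff, f.injective.eq_iff]
        have h1 : ((fun s => (Quot.out τ).1 s + p₁) = fun s => (Quot.out τ).1 s + q₁) ↔
            p₁ = q₁ := ⟨fun h => add_left_cancel (congrFun h ⟨0, hnα⟩), fun h => by rw [h]⟩
        have h2 : ((fun s => (Quot.out τ).2 s + p₂) = fun s => (Quot.out τ).2 s + q₂) ↔
            p₂ = q₂ := ⟨fun h => add_left_cancel (congrFun h ⟨0, hnβ⟩), fun h => by rw [h]⟩
        rw [h1, h2] }
  exact ⟨G.symm⟩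

open Classical in
theorem filter_mem_supp_eq_image (hα : Odd α) (hβ : Odd β) (τ : Torus α β nα nβ) :
    (Finset.univ.filter fun v => v ∈ τ.supp) = Finset.univ.image (torusShift τ.out) := by
  ext v
  simp [mem_supp_iff_exists_torusShift hα hβ τ v, -SimpleGraph.ConnectedComponent.mem_supp_iff]

open Classical in
theorem sum_mem_supp {M : Type*} [AddCommMonoid M] (hα : Odd α) (hβ : Odd β) (hnα : 1 ≤ nα)
    (hnβ : 1 ≤ nβ) (τ : Torus α β nα nβ) (f : MultiIndex α β nα nβ → M) :
    ∑ v with v ∈ τ.supp, f v = ∑ i, ∑ j, f (torusShift τ.out (i, j)) := by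
  rw [filter_mem_supp_eq_image hα hβ, Finset.sum_image (torusShift_injective hnα hnβ _).injOn,
    Fintype.sum_prod_type]

open Classical in
theorem sum_torus_sum_mem_supp {M : Type*} [AddCommMonoid M] (f : MultiIndex α β nα nβ → M) :
    ∑ τ : Torus α β nα nβ, ∑ v with v ∈ τ.supp, f v = ∑ v, f v := by
  rw [← Finset.sum_fiberwise Finset.univ (torusGraph α β nα nβ).connectedComponentMk f]
  refine Finset.sum_congr rfl fun τ _ => Finset.sum_congr ?_ fun _ _ => rfl
  ext v
  simp

/-- Count all vertices torus by torus: each torus has $\alpha\beta$ of them. -/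
theorem card_torus (hα : Odd α) (hβ : Odd β) (hnα : 1 ≤ nα) (hnβ : 1 ≤ nβ) :
    Fintype.card (Torus α β nα nβ) = α ^ (nα - 1) * β ^ (nβ - 1) := by
  have h := sum_torus_sum_mem_supp (α := α) (β := β) (nα := nα) (nβ := nβ) fun _ => 1
  simp only [sum_mem_supp hα hβ hnα hnβ] at h
  simp only [Finset.sum_const, Finset.card_univ, ZMod.card, smul_eq_mul, mul_one,
    Fintype.card_prod, Fintype.card_fun, Fintype.card_fin] at h
  obtain ⟨a, rfl⟩ := Nat.exists_eq_add_of_le' hnα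
  obtain ⟨b, rfl⟩ := Nat.exists_eq_add_of_le' hnβ
  refine Nat.eq_of_mul_eq_mul_right (Nat.mul_pos (NeZero.pos α) (NeZero.pos β)) ?_
  rw [h]
  simp only [Nat.add_sub_cancel]
  ring

/-- The regions `a'_i` of the torus through `u`. -/
def torusRegionA (u : MultiIndex α β nα nβ) (i : ZMod α) : Finset (Region α β nα nβ) :=
  Finset.univ.biUnion fun s => aRegion s (u.1 s + i)

/-- The regions `b'_j` of the torus through `u`. -/
def torusRegionB (u : MultiIndex α β nα nβ) (j : ZMod β) : Finset (Region α β nα nβ) :=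
  Finset.univ.biUnion fun t => bRegion t (u.2 t + j)

omit [NeZero α] [NeZero β] in
theorem consecutive_biUnion {ι : Type*} [Fintype ι] {R : Type*} [DecidableEq R]
    (a : ι → ZMod α → Finset R) (u : ι → ZMod α) (k : ℕ) (i : ZMod α) :
    consecutive (fun i => Finset.univ.biUnion fun s => a s (u s + i)) k i =
      Finset.univ.biUnion fun s => consecutive (a s) k (u s + i) := by
  ext r
  simp only [consecutive, Finset.mem_biUnion, Finset.mem_univ, true_and, add_assoc]
  constructor
  · rintro ⟨m, hm, s, hs⟩
    exact ⟨s, m, hm, hs⟩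
  · rintro ⟨s, m, hm, hs⟩
    exact ⟨m, hm, s, hs⟩

omit [NeZero α] [NeZero β] in
theorem isBoundaryPartition_torusRegion (hnα : 1 ≤ nα) (hnβ : 1 ≤ nβ)
    (u : MultiIndex α β nα nβ) : IsBoundaryPartition (torusRegionA u) (torusRegionB u) := by
  refine ⟨fun i => ⟨Sum.inl (⟨0, hnα⟩, u.1 ⟨0, hnα⟩ + i), ?_⟩,
    fun j => ⟨Sum.inr (⟨0, hnβ⟩, u.2 ⟨0, hnβ⟩ + j), ?_⟩, ?_⟩
  · simp [torusRegionA, aRegion]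
  · simp [torusRegionB, bRegion]
  · rintro (⟨s, i⟩ | ⟨t, j⟩)
    · refine ⟨Sum.inl (i - u.1 s), by simp [torusRegionA, aRegion], ?_⟩
      rintro (i' | j') h
      · simp only [Sum.elim_inl, torusRegionA, aRegion, Finset.mem_biUnion, Finset.mem_univ,
          true_and, Finset.mem_singleton, Sum.inl.injEq, Prod.mk.injEq] at h
        obtain ⟨s', rfl, rfl⟩ := h
        simp
      · simp [torusRegionB, bRegion] at h
    · refine ⟨Sum.inr (j - u.2 t), by simp [torusRegionB, bRegion], ?_⟩
      rintro (i' | j') h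
      · simp [torusRegionA, aRegion] at h
      · simp only [Sum.elim_inr, torusRegionB, bRegion, Finset.mem_biUnion, Finset.mem_univ,
          true_and, Finset.mem_singleton, Sum.inr.injEq, Prod.mk.injEq] at h
        obtain ⟨s', rfl, rfl⟩ := h
        simp

omit [NeZero β] in
theorem biUnion_torusRegionA (u : MultiIndex α β nα nβ) :
    Finset.univ.biUnion (torusRegionA u) = allA α β nα nβ := by
  ext r
  simp only [torusRegionA, allA, Finset.mem_biUnion, Finset.mem_univ, true_and]
  constructor
  · rintro ⟨i, s, h⟩
    exact ⟨s, _, h⟩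
  · rintro ⟨s, i, h⟩
    exact ⟨i - u.1 s, s, by simpa using h⟩

theorem toricInequality_torusRegion (hα : Odd α) (hβ : Odd β) (hnα : 1 ≤ nα) (hnβ : 1 ≤ nβ)
    (τ : Torus α β nα nβ) :
    toricInequality (torusRegionA τ.out) (torusRegionB τ.out) = torusPart τ := by
  have hL : ∀ i j, plusRegion (torusRegionA τ.out) i ∪ minusRegion (torusRegionB τ.out) j =
      leftRegion (torusShift τ.out (i, j)) := fun i j =>
    congrArg₂ (· ∪ ·) (consecutive_biUnion _ _ _ _) (consecutive_biUnion _ _ _ _)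
  have hR : ∀ i j, minusRegion (torusRegionA τ.out) i ∪ minusRegion (torusRegionB τ.out) j =
      rightRegion (torusShift τ.out (i, j)) := fun i j =>
    congrArg₂ (· ∪ ·) (consecutive_biUnion _ _ _ _) (consecutive_biUnion _ _ _ _)
  simp only [toricInequality, torusPart, sum_mem_supp hα hβ hnα hnβ, hL, hR, biUnion_torusRegionA]

/-- The coefficient of the non-geometric term is the number of tori, each contributing one copy. -/
theorem generalizedToricInequality_eq_sum (hα : Odd α) (hβ : Odd β) (hnα : 1 ≤ nα)
    (hnβ : 1 ≤ nβ) :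
    generalizedToricInequality α β nα nβ = ∑ τ : Torus α β nα nβ, torusPart τ := by
  refine Prod.ext ?_ ?_
  · rw [Prod.fst_sum]
    exact (sum_torus_sum_mem_supp _).symm
  · rw [Prod.snd_sum]
    simp only [torusPart, generalizedToricInequality, Finset.sum_add_distrib,
      sum_torus_sum_mem_supp, Finset.sum_const, Finset.card_univ, card_torus hα hβ hnα hnβ]
    congr 1
    simp [entropyTerm]

end Tori

theorem mainTheorem1 (α β nα nβ : ℕ) [NeZero α] [NeZero β]
    (hα : Odd α) (hβ : Odd β) (hnα : 1 ≤ nα) (hnβ : 1 ≤ nβ) :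
    -- the inequality is a holographic entropy inequality
    IsHEI (generalizedToricInequality α β nα nβ) ∧
    -- the graph is a disjoint union of the stated number of toroidal graphs
    Fintype.card (Torus α β nα nβ) = α ^ (nα - 1) * β ^ (nβ - 1) ∧
    (∀ τ : Torus α β nα nβ, Nonempty (τ.toSimpleGraph ≃g
      (SimpleGraph.cycleGraph α).boxProd (SimpleGraph.cycleGraph β))) ∧
    -- the inequality is the sum of toric inequalities, one for each torus
    ∃ (a : Torus α β nα nβ → ZMod α → Finset (Region α β nα nβ))
      (b : Torus α β nα nβ → ZMod β → Finset (Region α β nα nβ)),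
      (∀ τ, IsBoundaryPartition (a τ) (b τ)) ∧
      (∀ τ, toricInequality (a τ) (b τ) = torusPart τ) ∧
      (∀ τ, IsHEI (toricInequality (a τ) (b τ))) ∧
      generalizedToricInequality α β nα nβ = ∑ τ, toricInequality (a τ) (b τ) := by
  have hpart : ∀ τ : Torus α β nα nβ,
      IsBoundaryPartition (torusRegionA τ.out) (torusRegionB τ.out) := fun τ =>
    isBoundaryPartition_torusRegion hnα hnβ τ.out
  have hHEI : ∀ τ : Torus α β nα nβ,
      IsHEI (toricInequality (torusRegionA τ.out) (torusRegionB τ.out)) := fun τ =>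
    isHEI_toricInequality hα hβ (hpart τ)
  have hpt := toricInequality_torusRegion (α := α) (β := β) (nα := nα) (nβ := nβ) hα hβ hnα hnβ
  have hsum : generalizedToricInequality α β nα nβ =
      ∑ τ : Torus α β nα nβ, toricInequality (torusRegionA τ.out) (torusRegionB τ.out) := by
    simp only [hpt]
    exact generalizedToricInequality_eq_sum hα hβ hnα hnβ
  refine ⟨?_, card_torus hα hβ hnα hnβ, nonempty_torus_iso hα hβ hnα hnβ,
    fun τ => torusRegionA τ.out, fun τ => torusRegionB τ.out, hpart, hpt, hHEI, hsum⟩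
  rw [hsum]
  exact IsHEI.sum _ _ fun τ _ => hHEI τ
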